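/- Let $N\ge 1$ be an integer, let $\{k_1,\dots,k_M\}$ ($M\ge 0$) be a set of $M$ distinct integers with $0<k_j<N$, and put $\Lambda=\{0,\dots,N\}\setminus\{k_1,\dots,k_M\}$. Let $\mathcal P(\Lambda)$ be the complex vector space of polynomials $\sum_{k\in\Lambda}c_kz^k$, $c_k\in\mathbb C$, normed by $$\|p\|_1=\frac1{2\pi}\int_{\mathbb T}|p(\zeta)|\,|d\zeta|,\qquad \mathbb T=\{\zeta\in\mathbb C:|\zeta|=1\},$$ and let $\mathrm{ball}(\mathcal P(\Lambda))=\{q\in\mathcal P(\Lambda):\|q\|_1\le 1\}$. For $p(z)=\sum_{k=0}^Nc_kz^k\in\mathcal P(\Lambda)$ with $\|p\|_1=1$, let $p^*(z)=\sum_{k=0}^N\overline{c_k}\,z^{N-k}$, let $a_1,\dots,a_n$ be the distinct common zeros of $p$ and $p^*$ in the open unit disk $\mathbb D=\{z\in\mathbb C:|z|<1\}$, and put $$m=\sum_{j=1}^n\min\{\mathrm{mult}(a_j,p),\,\mathrm{mult}(a_j,p^*)\},$$ where $\mathrm{mult}(a,q)$ is the multiplicity of $a$ as a zero of $q$. If $M<m$,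 then $p$ is not an extreme point of $\mathrm{ball}(\mathcal P(\Lambda))$. -/

import Mathlib

namespace Fewnomial

open Polynomial

/-- The set `Λ = {0, …, N} \ K` of admissible frequencies, `K` being the finite set of
forbidden ones. -/
def freqSet (N : ℕ) (K : Finset ℕ) : Finset ℕ :=
  Finset.range (N + 1) \ K

/-- The complex vector space `𝒫(Λ)` of the polynomials `∑_{k ∈ Λ} c_k z^k`. -/
def polySpace (L : Finset ℕ) : Submodule ℂ ℂ[X] where
  carrier := {p | ∀ k, k ∉ L → p.coeff k = 0}
  zero_mem' := by
    intro k _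
    simp
  add_mem' := by
    intro p q hp hq k hk
    simp [hp k hk, hq k hk]
  smul_mem' := by
    intro c p hp k hk
    simp [hp k hk]

/-- The norm `‖p‖₁ = (1 / 2π) ∫ |p(ζ)| |dζ|` over the unit circle. -/
noncomputable def l1Norm (p : ℂ[X]) : ℝ :=
  (2 * Real.pi)⁻¹ * ∫ t in (0 : ℝ)..(2 * Real.pi), ‖p.eval (Complex.exp (t * Complex.I))‖

/-- The closed unit ball of `(𝒫(Λ), ‖·‖₁)`. -/
def unitBall (L : Finset ℕ) : Set (polySpace L) :=
  {p | l1Norm (p : ℂ[X]) ≤ 1}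

/-- For `p = ∑_{k ≤ N} c_k z^k`, the polynomial `p* = ∑_{k ≤ N} conj(c_k) z^(N-k)`. -/
noncomputable def starPoly (N : ℕ) (p : ℂ[X]) : ℂ[X] :=
  ∑ k ∈ Finset.range (N + 1), C (starRingEnd ℂ (p.coeff k)) * X ^ (N - k)

open Classical in
/-- The distinct common zeros of `p` and `q` in the open unit disk (for `p, q ≠ 0`). -/
noncomputable def commonZeros (p q : ℂ[X]) : Finset ℂ :=
  (p.roots.toFinset ∩ q.roots.toFinset).filter (fun a => ‖a‖ < 1)

/-- The number `m = ∑_j min {mult(a_j, p), mult(a_j, p*)}`, where the `a_j` are the distinct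
common zeros of `p` and `p*` in the open unit disk. -/
noncomputable def commonMult (N : ℕ) (p : ℂ[X]) : ℕ :=
  ∑ a ∈ commonZeros p (starPoly N p),
    min (p.rootMultiplicity a) ((starPoly N p).rootMultiplicity a)

end Fewnomial

/-!
On the unit circle `p*(z) = z ^ N * conj (p z)`. Collect the common zeros of `p` and `p*` in the
open disk, with multiplicity, in a monic polynomial `G` of degree `m`. Since `p** = p`, also `G*`
divides `p`; its zeros lie outside the disk, so it is coprime to `G`, and `p = G G* r` with
`deg r ≤ N - 2 m`. On the circle `p` equals `z ^ m * |G| ^ 2 * r`. If a real trigonometric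
polynomial `τ` of degree at most `m` satisfies `|τ| ≤ |G| ^ 2` and `∫ |r| τ = 0`, then adding
`± z ^ m * τ * r` to `p` does not change the norm. The real trigonometric polynomials of degree
at most `m` have dimension `2 m + 1`; the integral and the `M` forbidden coefficients impose
`2 M + 1` real linear conditions, so for `M < m` some `τ ≠ 0` meets them, and scaling makes it
small.
-/

namespace Fewnomial

open Polynomial Metric

open Real (circleAverage)

open scoped ComplexConjugate

variable {N m n : ℕ} {K : Finset ℕ} {p q G Q r u : ℂ[X]} {z : ℂ}

section StarPoly

theorem coeff_starPoly (N : ℕ) (p : ℂ[X]) (k : ℕ) :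
    (starPoly N p).coeff k = if k ≤ N then conj (p.coeff (N - k)) else 0 := by
  simp only [starPoly, finsetSum_coeff, coeff_C_mul_X_pow]
  split_ifs with hk
  · rw [Finset.sum_eq_single_of_mem (N - k) (by simp) fun j hj hne => if_neg ?_,
      if_pos (by omega)]
    rw [Finset.mem_range] at hj
    omega
  · exact Finset.sum_eq_zero fun j _ => if_neg (by omega)

theorem natDegree_starPoly_le (N : ℕ) (p : ℂ[X]) : (starPoly N p).natDegree ≤ N :=
  natDegree_le_iff_coeff_eq_zero.2 fun k hk => by rw [coeff_starPoly, if_neg (by omega)]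

theorem starPoly_starPoly (hp : p.natDegree ≤ N) : starPoly N (starPoly N p) = p := by
  ext k
  by_cases hk : k ≤ N
  · simp [coeff_starPoly, hk, Nat.sub_sub_self hk]
  · simp [coeff_starPoly, hk, coeff_eq_zero_of_natDegree_lt (hp.trans_lt (not_le.1 hk))]

theorem starPoly_eq_reflect (hp : p.natDegree ≤ N) :
    starPoly N p = reflect N (p.map (starRingEnd ℂ)) := by
  ext k
  rw [coeff_starPoly, coeff_reflect, coeff_map]
  split_ifs with hk
  · rw [revAt_le hk]
  · rw [revAt_eq_self_of_lt (not_le.1 hk), coeff_eq_zero_of_natDegree_lt (by omega), map_zero]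

theorem starPoly_mul (hp : p.natDegree ≤ m) (hq : q.natDegree ≤ n) :
    starPoly (m + n) (p * q) = starPoly m p * starPoly n q := by
  rw [starPoly_eq_reflect hp, starPoly_eq_reflect hq,
    starPoly_eq_reflect (natDegree_mul_le.trans (add_le_add hp hq)), Polynomial.map_mul,
    reflect_mul _ _ (by rwa [natDegree_map]) (by rwa [natDegree_map])]

theorem eval_starPoly (hp : p.natDegree ≤ N) (hz : z ≠ 0) :
    (starPoly N p).eval z = z ^ N * conj (p.eval (conj z)⁻¹) := by
  rw [eval_eq_sum_range' (Nat.lt_succ_of_le hp), starPoly, eval_finsetSum, map_sum,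
    Finset.mul_sum]
  refine Finset.sum_congr rfl fun k hk => ?_
  simp only [eval_mul, eval_C, eval_pow, eval_X, map_mul, map_pow, map_inv₀, Complex.conj_conj]
  rw [pow_sub₀ _ hz (Finset.mem_range_succ_iff.1 hk), inv_pow]
  ring

theorem eval_starPoly_of_mem_sphere (hp : p.natDegree ≤ N) (hz : z ∈ sphere (0 : ℂ) 1) :
    (starPoly N p).eval z = z ^ N * conj (p.eval z) := by
  rw [eval_starPoly hp (ne_of_mem_sphere hz one_ne_zero), ← map_inv₀,
    Complex.inv_eq_conj (mem_sphere_zero_iff_norm.1 hz), Complex.conj_conj]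

theorem isCoprime_starPoly (hG : G ≠ 0) (hroot : ∀ a, G.IsRoot a → ‖a‖ < 1) :
    IsCoprime G (starPoly G.natDegree G) := by
  rw [isCoprime_iff_aeval_ne_zero_of_isAlgClosed ℂ ℂ]
  intro a
  by_contra! h
  simp only [coe_aeval_eq_eval] at h
  obtain ⟨hGa, hstar⟩ := h
  obtain rfl | ha := eq_or_ne a 0
  · rw [← coeff_zero_eq_eval_zero, coeff_starPoly] at hstar
    simp [hG] at hstar
  · rw [eval_starPoly le_rfl ha] at hstar
    have hinv : ‖(conj a)⁻¹‖ < 1 := hroot _ (by simpa [ha] using hstar)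
    rw [norm_inv, RCLike.norm_conj] at hinv
    exact hinv.not_ge ((one_le_inv₀ (norm_pos_iff.2 ha)).2 (hroot a hGa).le)

theorem exists_eq_mul_starPoly_mul (hp : p.natDegree ≤ N) (hp0 : p ≠ 0)
    (hroot : ∀ a, G.IsRoot a → ‖a‖ < 1) (hGp : G ∣ p) (hGs : G ∣ starPoly N p) :
    ∃ r, p = G * starPoly G.natDegree G * r ∧ r.natDegree + 2 * G.natDegree ≤ N := by
  have hG0 : G ≠ 0 := ne_zero_of_dvd_ne_zero hp0 hGp
  obtain ⟨h, hh⟩ := hGs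
  have hh0 : h ≠ 0 := by
    rintro rfl
    apply hp0
    rw [← starPoly_starPoly hp, hh]
    simp [starPoly]
  have hdeg : G.natDegree + h.natDegree ≤ N := by
    rw [← natDegree_mul hG0 hh0, ← hh]
    exact natDegree_starPoly_le N p
  obtain ⟨n, rfl⟩ := Nat.exists_eq_add_of_le (Nat.le_of_add_right_le hdeg)
  have hfac : p = starPoly G.natDegree G * starPoly n h := by
    rw [← starPoly_mul le_rfl (by omega), ← hh, starPoly_starPoly hp]
  obtain ⟨r, hr⟩ : G ∣ starPoly n h :=
    (isCoprime_starPoly hG0 hroot).dvd_of_dvd_mul_left (hfac ▸ hGp)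
  have hr0 : r ≠ 0 := by
    rintro rfl
    exact hp0 (by rw [hfac, hr]; simp)
  have hdeg' := natDegree_starPoly_le n h
  rw [hr, natDegree_mul hG0 hr0] at hdeg'
  exact ⟨r, by rw [mul_comm G, mul_assoc, ← hr, ← hfac], by omega⟩

end StarPoly

section DiskGCD

/-- The greatest common divisor of the parts of `p` and `q` carried by their zeros in the open unit
disk, for `p, q ≠ 0`. For `q = starPoly N p` its degree is the number `m` of the paper. -/
noncomputable def diskGCD (p q : ℂ[X]) : ℂ[X] :=
  ∏ a ∈ commonZeros p q, (X - C a) ^ min (p.rootMultiplicity a) (q.rootMultiplicity a)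

theorem natDegree_diskGCD_starPoly (N : ℕ) (p : ℂ[X]) :
    (diskGCD p (starPoly N p)).natDegree = commonMult N p := by
  rw [diskGCD, natDegree_prod_of_monic _ _ fun a _ => (monic_X_sub_C a).pow _, commonMult]
  simp only [natDegree_pow, natDegree_X_sub_C, mul_one]

theorem norm_lt_one_of_isRoot_diskGCD {a : ℂ} (ha : (diskGCD p q).IsRoot a) : ‖a‖ < 1 := by
  rw [diskGCD, isRoot_prod] at ha
  obtain ⟨b, hb, hab⟩ := ha
  rw [IsRoot, eval_pow] at hab
  obtain rfl : b = a := root_X_sub_C.1 (eq_zero_of_pow_eq_zero hab)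
  exact (Finset.mem_filter.1 hb).2

theorem pairwise_isCoprime_X_sub_C_pow (s : Set ℂ) (μ : ℂ → ℕ) :
    s.Pairwise (Function.onFun IsCoprime fun a => (X - C a) ^ μ a) :=
  fun _ _ _ _ hab => (pairwise_coprime_X_sub_C Function.injective_id hab).pow

theorem diskGCD_dvd_left (p q : ℂ[X]) : diskGCD p q ∣ p :=
  Finset.prod_dvd_of_coprime (pairwise_isCoprime_X_sub_C_pow _ _) fun a _ =>
    (pow_dvd_pow _ (min_le_left _ _)).trans (pow_rootMultiplicity_dvd p a)

theorem diskGCD_dvd_right (p q : ℂ[X]) : diskGCD p q ∣ q :=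
  Finset.prod_dvd_of_coprime (pairwise_isCoprime_X_sub_C_pow _ _) fun a _ =>
    (pow_dvd_pow _ (min_le_right _ _)).trans (pow_rootMultiplicity_dvd q a)

end DiskGCD

section Symmetrize

/-- The polynomial `z ^ m * τ(z)`, where `τ = 2 Re Q` on the unit circle. As `Q` runs through the
polynomials of degree at most `m` with `Q(0)` real, `τ` runs through the real trigonometric
polynomials of degree at most `m`. -/
noncomputable def symmetrize (m : ℕ) : ℂ[X] →ₗ[ℝ] ℂ[X] where
  toFun Q := X ^ m * Q + starPoly m Q
  map_add' P Q := by
    ext k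
    simp only [coeff_add, coeff_X_pow_mul', coeff_starPoly, map_add]
    split_ifs <;> ring
  map_smul' s Q := by
    ext k
    simp only [coeff_add, coeff_smul, coeff_X_pow_mul', coeff_starPoly, Complex.real_smul, map_mul,
      Complex.conj_ofReal, RingHom.id_apply]
    split_ifs <;> ring

theorem symmetrize_apply (m : ℕ) (Q : ℂ[X]) : symmetrize m Q = X ^ m * Q + starPoly m Q := rfl

theorem eval_symmetrize (hQ : Q.natDegree ≤ m) (hz : z ∈ sphere (0 : ℂ) 1) :
    (symmetrize m Q).eval z = z ^ m * ((2 * (Q.eval z).re : ℝ) : ℂ) := by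
  rw [symmetrize_apply, eval_add, eval_mul, eval_pow, eval_X, eval_starPoly_of_mem_sphere hQ hz,
    ← mul_add, Complex.add_conj]

theorem natDegree_symmetrize_le (hQ : Q.natDegree ≤ m) : (symmetrize m Q).natDegree ≤ 2 * m := by
  rw [symmetrize_apply]
  refine natDegree_add_le_of_degree_le (natDegree_mul_le.trans ?_)
    ((natDegree_starPoly_le m Q).trans (by omega))
  rw [natDegree_X_pow]
  omega

theorem symmetrize_ne_zero (hQ0 : Q ≠ 0) (him : (Q.coeff 0).im = 0) : symmetrize m Q ≠ 0 := by
  contrapose! hQ0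
  have hcoeff (k : ℕ) : Q.coeff k + (starPoly m Q).coeff (k + m) = 0 := by
    rw [← coeff_X_pow_mul Q m k, ← coeff_add, ← symmetrize_apply, hQ0, coeff_zero]
  ext k
  specialize hcoeff k
  rw [coeff_starPoly] at hcoeff
  obtain rfl | hk := eq_or_ne k 0
  · have hre : (Q.coeff 0).re = 0 := by simpa [Complex.add_conj] using hcoeff
    exact Complex.ext hre him
  · rwa [if_neg (by omega), add_zero] at hcoeff

end Symmetrize

section Norm

theorem l1Norm_eq_circleAverage (p : ℂ[X]) :
    l1Norm p = circleAverage (fun z => ‖p.eval z‖) 0 1 := by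
  simp [l1Norm, circleAverage, circleMap]

theorem l1Norm_add_eq_self {w τ : ℂ → ℝ} (hτ : ContinuousOn τ (sphere 0 1))
    (hp : ∀ z ∈ sphere (0 : ℂ) 1, p.eval z = u.eval z * w z)
    (hq : ∀ z ∈ sphere (0 : ℂ) 1, q.eval z = u.eval z * τ z)
    (hle : ∀ z ∈ sphere (0 : ℂ) 1, |τ z| ≤ w z)
    (hmean : circleAverage (fun z => ‖u.eval z‖ * τ z) 0 1 = 0) :
    l1Norm (p + q) = l1Norm p := by
  have hnorm : Set.EqOn (fun z => ‖(p + q).eval z‖)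
      (fun z => ‖p.eval z‖ + ‖u.eval z‖ * τ z) (sphere 0 |1|) := by
    intro z hz
    rw [abs_one] at hz
    have hw : 0 ≤ w z := (abs_nonneg _).trans (hle z hz)
    have hwτ : 0 ≤ w z + τ z := by linarith [neg_le_of_abs_le (hle z hz)]
    beta_reduce
    rw [eval_add, hp z hz, hq z hz, ← mul_add, ← Complex.ofReal_add, norm_mul, norm_mul,
      Complex.norm_of_nonneg hwτ, Complex.norm_of_nonneg hw, mul_add]
  rw [l1Norm_eq_circleAverage, l1Norm_eq_circleAverage, Real.circleAverage_congr_sphere hnorm,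
    Real.circleAverage_fun_add, hmean, add_zero]
  · exact p.continuous.norm.continuousOn.circleIntegrable zero_le_one
  · exact (u.continuous.norm.continuousOn.mul hτ).circleIntegrable zero_le_one

/-- The mean of `|u| τ` over the unit circle, as a function of the polynomial `Q` with
`τ = 2 Re Q`. -/
noncomputable def weightedMean (u : ℂ[X]) : ℂ[X] →ₗ[ℝ] ℝ where
  toFun Q := circleAverage (fun z => ‖u.eval z‖ * (2 * (Q.eval z).re)) 0 1
  map_add' P Q := by
    rw [← Real.circleAverage_fun_add]
    · simp only [eval_add, Complex.add_re, mul_add]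
    all_goals exact ContinuousOn.circleIntegrable zero_le_one (by fun_prop)
  map_smul' s Q := by
    rw [RingHom.id_apply, ← Real.circleAverage_fun_smul]
    simp only [eval_smul, Complex.smul_re, smul_eq_mul, mul_left_comm]

theorem l1Norm_add_mul_symmetrize (hG : G.natDegree ≤ m) (hQ : Q.natDegree ≤ m)
    (hle : ∀ z ∈ sphere (0 : ℂ) 1, |2 * (Q.eval z).re| ≤ ‖G.eval z‖ ^ 2)
    (hmean : weightedMean (X ^ m * r) Q = 0) :
    l1Norm (G * starPoly m G * r + r * symmetrize m Q) = l1Norm (G * starPoly m G * r) := by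
  refine l1Norm_add_eq_self (u := X ^ m * r) (by fun_prop) (fun z hz => ?_) (fun z hz => ?_)
    hle hmean
  · rw [eval_mul, eval_mul, eval_mul, eval_pow, eval_X, eval_starPoly_of_mem_sphere hG hz,
      Complex.ofReal_pow, ← Complex.mul_conj']
    ring
  · rw [eval_mul, eval_mul, eval_pow, eval_X, eval_symmetrize hQ hz]
    ring

end Norm

section Perturbation

theorem exists_ne_zero_natDegree_le_map_eq_zero {W : Type*} [AddCommGroup W] [Module ℝ W]
    [FiniteDimensional ℝ W] (hW : Module.finrank ℝ W < 2 * (m + 1)) (L : ℂ[X] →ₗ[ℝ] W) :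
    ∃ Q ≠ 0, Q.natDegree ≤ m ∧ L Q = 0 := by
  let ι : (Fin (m + 1) → ℂ) →ₗ[ℝ] ℂ[X] :=
    ((degreeLT ℂ (m + 1)).subtype ∘ₗ (degreeLTEquiv ℂ (m + 1)).symm.toLinearMap).restrictScalars ℝ
  have hι : Function.Injective ι :=
    Subtype.val_injective.comp (degreeLTEquiv ℂ (m + 1)).symm.injective
  have hdim : Module.finrank ℝ (Fin (m + 1) → ℂ) = 2 * (m + 1) := by
    rw [Module.finrank_pi_fintype]
    simp [Complex.finrank_real_complex, mul_comm]
  obtain ⟨c, hLc, hc0⟩ := Submodule.exists_mem_ne_zero_of_ne_bot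
    ((L ∘ₗ ι).ker_ne_bot_of_finrank_lt (hdim ▸ hW))
  have hQ0 : ι c ≠ 0 := (map_ne_zero_iff ι hι).2 hc0
  have hdeg : (ι c).degree < (m + 1 : ℕ) :=
    mem_degreeLT.1 ((degreeLTEquiv ℂ (m + 1)).symm c).2
  exact ⟨ι c, hQ0, Nat.lt_succ_iff.1 ((natDegree_lt_iff_degree_lt hQ0).2 hdeg), hLc⟩

theorem exists_ne_zero_weightedMean_eq_zero (hK : K.card < m) (r : ℂ[X]) :
    ∃ Q ≠ 0, Q.natDegree ≤ m ∧ (Q.coeff 0).im = 0 ∧ weightedMean (X ^ m * r) Q = 0 ∧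
      ∀ k ∈ K, (r * symmetrize m Q).coeff k = 0 := by
  let coeffIm : ℂ[X] →ₗ[ℝ] ℝ := Complex.imLm ∘ₗ (lcoeff ℂ 0).restrictScalars ℝ
  let forbidden : ℂ[X] →ₗ[ℝ] K → ℂ := LinearMap.pi fun k =>
    (lcoeff ℂ k).restrictScalars ℝ ∘ₗ LinearMap.mulLeft ℝ r ∘ₗ symmetrize m
  have hdim : Module.finrank ℝ (ℝ × ℝ × (K → ℂ)) < 2 * (m + 1) := by
    have hpi : Module.finrank ℝ (K → ℂ) = K.card * 2 := by
      simp [Module.finrank_pi_fintype, Complex.finrank_real_complex]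
    rw [Module.finrank_prod, Module.finrank_prod, Module.finrank_self, hpi]
    omega
  obtain ⟨Q, hQ0, hQ, hL⟩ := exists_ne_zero_natDegree_le_map_eq_zero hdim
    ((weightedMean (X ^ m * r)).prod (coeffIm.prod forbidden))
  obtain ⟨hmean, him, hforbidden⟩ : weightedMean (X ^ m * r) Q = 0 ∧ coeffIm Q = 0 ∧
      forbidden Q = 0 := by simpa [Prod.ext_iff] using hL
  exact ⟨Q, hQ0, hQ, him, hmean, fun k hk => congrFun hforbidden ⟨k, hk⟩⟩

theorem exists_pos_forall_mul_abs_le {α : Type*} [TopologicalSpace α] {s : Set α} {w τ : α → ℝ}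
    (hs : IsCompact s) (hw : ContinuousOn w s) (hτ : ContinuousOn τ s) (hpos : ∀ x ∈ s, 0 < w x) :
    ∃ ε > 0, ∀ x ∈ s, ε * |τ x| ≤ w x := by
  obtain ⟨B, hB⟩ := hs.exists_bound_of_continuousOn (hτ.div hw fun x hx => (hpos x hx).ne')
  refine ⟨(|B| + 1)⁻¹, by positivity, fun x hx => ?_⟩
  have hratio : |τ x| / w x ≤ |B| + 1 := by
    have hle := (hB x hx).trans (le_abs_self B)
    rw [Pi.div_apply, Real.norm_eq_abs, abs_div, abs_of_pos (hpos x hx)] at hle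
    linarith
  rwa [inv_mul_le_iff₀ (by positivity), ← div_le_iff₀ (hpos x hx)]

theorem exists_l1Norm_preserving_perturbation (hK : K.card < m) (hG : G.natDegree ≤ m)
    (hG0 : ∀ z ∈ sphere (0 : ℂ) 1, G.eval z ≠ 0) (hr : r ≠ 0) :
    ∃ q ≠ 0, q.natDegree ≤ r.natDegree + 2 * m ∧ (∀ k ∈ K, q.coeff k = 0) ∧
      l1Norm (G * starPoly m G * r + q) = l1Norm (G * starPoly m G * r) ∧
      l1Norm (G * starPoly m G * r - q) = l1Norm (G * starPoly m G * r) := by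
  obtain ⟨Q, hQ0, hQ, him, hmean, hcoeff⟩ := exists_ne_zero_weightedMean_eq_zero hK r
  obtain ⟨ε, hε, hle⟩ := exists_pos_forall_mul_abs_le (isCompact_sphere (0 : ℂ) 1)
    (w := fun z => ‖G.eval z‖ ^ 2) (τ := fun z => 2 * (Q.eval z).re) (by fun_prop) (by fun_prop)
    fun z hz => pow_pos (norm_pos_iff.2 (hG0 z hz)) 2
  have hnorm (s : ℝ) (hs : |s| = ε) :
      l1Norm (G * starPoly m G * r + r * symmetrize m (s • Q)) =
        l1Norm (G * starPoly m G * r) := by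
    refine l1Norm_add_mul_symmetrize hG ((natDegree_smul_le _ _).trans hQ) (fun z hz => ?_) ?_
    · rw [eval_smul, Complex.smul_re, smul_eq_mul, mul_left_comm, abs_mul, hs]
      exact hle z hz
    · rw [map_smul, hmean, smul_zero]
  refine ⟨ε • (r * symmetrize m Q), ?_, ?_, fun k hk => ?_, ?_, ?_⟩
  · exact smul_ne_zero hε.ne' (mul_ne_zero hr (symmetrize_ne_zero hQ0 him))
  · exact (natDegree_smul_le _ _).trans
      (natDegree_mul_le.trans (Nat.add_le_add_left (natDegree_symmetrize_le hQ) _))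
  · rw [coeff_smul, hcoeff k hk, smul_zero]
  · rw [← mul_smul_comm, ← map_smul]
    exact hnorm ε (abs_of_pos hε)
  · rw [sub_eq_add_neg, ← neg_smul, ← mul_smul_comm, ← map_smul]
    exact hnorm (-ε) (by rw [abs_neg, abs_of_pos hε])

end Perturbation

theorem mem_polySpace_freqSet :
    p ∈ polySpace (freqSet N K) ↔ p.natDegree ≤ N ∧ ∀ k ∈ K, p.coeff k = 0 := by
  have hfreq (k : ℕ) : k ∉ freqSet N K ↔ N < k ∨ k ∈ K := by
    simp only [freqSet, Finset.mem_sdiff, Finset.mem_range]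
    grind
  change (∀ k, k ∉ freqSet N K → p.coeff k = 0) ↔ _
  simp only [hfreq, or_imp, forall_and, natDegree_le_iff_coeff_eq_zero]

theorem notMem_extremePoints_of_add_mem_of_sub_mem {E : Type*} [AddCommGroup E] [Module ℝ E]
    {A : Set E} {x y : E} (hy : y ≠ 0) (hadd : x + y ∈ A) (hsub : x - y ∈ A) :
    x ∉ A.extremePoints ℝ := by
  intro hx
  have hends : x - y = x :=
    (mem_extremePoints_iff_left.1 hx).2 _ hsub _ hadd (mem_openSegment_sub_add x y)
  exact hy (sub_eq_self.1 hends)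

end Fewnomial

open Fewnomial in
theorem corollary2p2_general {N : ℕ} {K : Finset ℕ} {p : polySpace (freqSet N K)}
    (hm : K.card < commonMult N (p : Polynomial ℂ)) :
    p ∉ Set.extremePoints ℝ (unitBall (freqSet N K)) := by
  intro hext
  obtain ⟨p, hmem⟩ := p
  obtain ⟨hpN, hpK⟩ := mem_polySpace_freqSet.1 hmem
  have hp0 : p ≠ 0 := by
    rintro rfl
    simp [commonMult, commonZeros] at hm
  obtain ⟨r, hpr, hrN⟩ := exists_eq_mul_starPoly_mul hpN hp0
    (fun a => norm_lt_one_of_isRoot_diskGCD) (diskGCD_dvd_left _ _) (diskGCD_dvd_right _ _)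
  rw [natDegree_diskGCD_starPoly] at hpr hrN
  obtain ⟨q, hq0, hqr, hqK, hadd, hsub⟩ := exists_l1Norm_preserving_perturbation hm
    (natDegree_diskGCD_starPoly N p).le
    (fun z hz h => (norm_lt_one_of_isRoot_diskGCD h).ne (mem_sphere_zero_iff_norm.1 hz))
    (right_ne_zero_of_mul (hpr ▸ hp0))
  rw [← hpr] at hadd hsub
  have hq : q ∈ polySpace (freqSet N K) := mem_polySpace_freqSet.2 ⟨hqr.trans hrN, hqK⟩
  have hball : l1Norm p ≤ 1 := hext.1
  exact notMem_extremePoints_of_add_mem_of_sub_mem (y := ⟨q, hq⟩)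
    (fun h => hq0 (congrArg Subtype.val h)) (hadd.trans_le hball) (hsub.trans_le hball) hext

theorem corollary2p2 (N : ℕ) (hN : 0 < N) (K : Finset ℕ) (hK : ∀ k ∈ K, 0 < k ∧ k < N)
    (p : Fewnomial.polySpace (Fewnomial.freqSet N K))
    (hp : Fewnomial.l1Norm (p : Polynomial ℂ) = 1)
    (hm : K.card < Fewnomial.commonMult N (p : Polynomial ℂ)) :
    p ∉ Set.extremePoints ℝ (Fewnomial.unitBall (Fewnomial.freqSet N K)) :=
  corollary2p2_general hm
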